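/- Let $d\ge 1$ and $q\in(2,\infty)$. For $f\in L^1(\mathbb R^d)$ write $\widehat f(\xi)=\int_{\mathbb R^d}e^{-2\pi i x\cdot\xi}f(x)\,dx$, extended to $L^2(\mathbb R^d)$ by Plancherel's theorem. Let $\mathbb B=\{x\in\mathbb R^d:|x|\le 1\}$. For a Lebesgue measurable set $E\subset\mathbb R^d$ with measure $|E|\in(0,\infty)$ put $$\Phi_q(E)=|E|^{-1/q'}\,\|\widehat{\mathbf 1_E}\|_{L^q(\mathbb R^d)},\qquad q'=\frac{q}{q-1},$$ $$\operatorname{dist}(E,\mathfrak E)=\inf_{\mathcal E}\frac{|\mathcal E\,\triangle\,E|}{|E|},$$ where the infimum is over all ellipsoids $\mathcal E$ (images of $\mathbb B$ under affine automorphisms of $\mathbb R^d$) with $|\mathcal E|=|E|$. Say that ellipsoids are local maximizers of $\Phi_q$ if there is $\eta>0$ such that $\Phi_q(\mathbb B)\ge\Phi_q(E)$ for every Lebesgue measurable $E\subset\mathbb R^d$ with $|E|\in(0,\infty)$ and $\operatorname{dist}(E,\mathfrak E)<\eta$. Let $K_q\in L^2(\mathbb R^d)$ be the real-valued function defined by $\widehat{K_q}=\widehat{\mathbf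 1_{\mathbb B}}\,|\widehat{\mathbf 1_{\mathbb B}}|^{q-2}$. If ellipsoids are local maximizers of $\Phi_q$, then $$\operatorname*{ess\,inf}_{|x|\le 1}K_q(x)\ \ge\ \operatorname*{ess\,sup}_{|x|\ge 1}K_q(x).$$ -/

import Mathlib

open MeasureTheory FourierTransform
open scoped ENNReal SchwartzMap symmDiff

noncomputable section

namespace FourierIndicator

/-- The indicator function `1_E`, as a complex-valued function on `ℝ^d`. -/
def ind {d : ℕ} (E : Set (EuclideanSpace ℝ (Fin d))) : EuclideanSpace ℝ (Fin d) → ℂ :=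
  E.indicator (fun _ => (1 : ℂ))

/-- The closed unit ball `𝔹` of `ℝ^d`. -/
def unitBall (d : ℕ) : Set (EuclideanSpace ℝ (Fin d)) := {x | ‖x‖ ≤ 1}

/-- An ellipsoid is the image of the closed unit ball under an affine automorphism of `ℝ^d`. -/
def IsEllipsoid {d : ℕ} (S : Set (EuclideanSpace ℝ (Fin d))) : Prop :=
  ∃ T : EuclideanSpace ℝ (Fin d) ≃ᵃ[ℝ] EuclideanSpace ℝ (Fin d), S = T '' unitBall d

/-- `Φ_q(E) = |E|^{-1/q'} ‖(1_E)^‖_{L^q}` with `q' = q/(q-1)`, as an extended nonnegative real.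
`𝓕` is the Fourier integral with kernel `exp(-2πi x·ξ)`. -/
def Phi {d : ℕ} (q : ℝ) (E : Set (EuclideanSpace ℝ (Fin d))) : ℝ≥0∞ :=
  volume E ^ (-(1 / (q / (q - 1)))) * eLpNorm (𝓕 (ind E)) (ENNReal.ofReal q) volume

/-- `dist(E, 𝔈)`: the infimum of `|S ∆ E| / |E|` over all ellipsoids `S` with `|S| = |E|`
(used for `0 < |E| < ∞`). -/
def distEllipsoids {d : ℕ} (E : Set (EuclideanSpace ℝ (Fin d))) : ℝ≥0∞ :=
  ⨅ (S : Set (EuclideanSpace ℝ (Fin d))) (_ : IsEllipsoid S) (_ : volume S = volume E),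
    volume (S ∆ E) / volume E

/-- Ellipsoids are local maximizers of `Φ_q` on `ℝ^d`. `NullMeasurableSet` is Lebesgue
measurability. -/
def EllipsoidsLocalMax (d : ℕ) (q : ℝ) : Prop :=
  ∃ η : ℝ, 0 < η ∧ ∀ E : Set (EuclideanSpace ℝ (Fin d)), NullMeasurableSet E volume →
    0 < volume E → volume E < ∞ → distEllipsoids E < ENNReal.ofReal η →
      Phi q E ≤ Phi q (unitBall d)

/-- The function `(1_𝔹)^ |(1_𝔹)^|^{q-2}` on `ℝ^d`. -/
def kernelHat (d : ℕ) (q : ℝ) (ξ : EuclideanSpace ℝ (Fin d)) : ℂ :=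
  𝓕 (ind (unitBall d)) ξ * ((‖𝓕 (ind (unitBall d)) ξ‖ ^ (q - 2) : ℝ) : ℂ)

/-- For `f ∈ L¹ ∩ L²` the Fourier integral of `f` represents the `L²` Fourier transform. -/
theorem fourier_ae_eq {d : ℕ} {f : EuclideanSpace ℝ (Fin d) → ℂ}
    (h1 : Integrable f) (h2 : MemLp f 2) :
    ((𝓕 (h2.toLp f) : Lp (α := EuclideanSpace ℝ (Fin d)) ℂ 2) :
      EuclideanSpace ℝ (Fin d) → ℂ) =ᵐ[volume] 𝓕 f := by
  have hcont : Continuous (𝓕 f) :=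
    VectorFourier.fourierIntegral_continuous Real.continuous_fourierChar
      (L := innerₗ (EuclideanSpace ℝ (Fin d))) continuous_inner h1
  apply ae_eq_of_integral_contDiff_smul_eq
  · exact (Lp.memLp _).locallyIntegrable (by norm_num)
  · exact hcont.locallyIntegrable
  intro g hg hgc
  have hg₁ : HasCompactSupport (Complex.ofRealCLM ∘ g) := hgc.comp_left rfl
  have hg₂ : ContDiff ℝ ((⊤ : ℕ∞) : WithTop ℕ∞) (Complex.ofRealCLM ∘ g) := by fun_prop
  set φ : 𝓢(EuclideanSpace ℝ (Fin d), ℂ) := hg₁.toSchwartzMap hg₂ with hφ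
  have hφx : ∀ x, φ x = (g x : ℂ) := fun x => rfl
  have key := congrArg (fun T => T φ) (Lp.fourier_toTemperedDistribution_eq (h2.toLp f))
  simp only [TemperedDistribution.fourier_apply, Lp.toTemperedDistribution_apply] at key
  have e1 : ∀ F : EuclideanSpace ℝ (Fin d) → ℂ, ∫ x, g x • F x = ∫ x, φ x • F x := by
    intro F; rfl
  rw [e1, e1, ← key]
  have e2 : ∫ x, (𝓕 φ) x • (h2.toLp f : EuclideanSpace ℝ (Fin d) → ℂ) x
      = ∫ x, (𝓕 (φ : EuclideanSpace ℝ (Fin d) → ℂ)) x • f x := by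
    apply integral_congr_ae
    filter_upwards [h2.coeFn_toLp] with x hx
    rw [hx, SchwartzMap.fourier_coe]
  rw [e2]
  have := VectorFourier.integral_fourierIntegral_smul_eq_flip
    (L := innerₗ (EuclideanSpace ℝ (Fin d))) (μ := volume) (ν := volume)
    Real.continuous_fourierChar continuous_inner φ.integrable h1
  rw [flip_innerₗ] at this
  exact this

theorem volume_unitBall_lt_top (d : ℕ) : volume (unitBall d) < ∞ := by
  have : unitBall d = Metric.closedBall 0 1 := by ext x; simp [unitBall]
  rw [this]; exact measure_closedBall_lt_top

theorem measurableSet_unitBall (d : ℕ) : MeasurableSet (unitBall d) :=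
  (isClosed_le continuous_norm continuous_const).measurableSet

theorem memLp_ind_unitBall (d : ℕ) (p : ℝ≥0∞) : MemLp (ind (unitBall d)) p :=
  memLp_indicator_const p (measurableSet_unitBall d) 1 (Or.inr (volume_unitBall_lt_top d).ne)

theorem integrable_ind_unitBall (d : ℕ) : Integrable (ind (unitBall d)) :=
  memLp_one_iff_integrable.1 (memLp_ind_unitBall d 1)

theorem continuous_fourier_ind (d : ℕ) : Continuous (𝓕 (ind (unitBall d))) :=
  VectorFourier.fourierIntegral_continuous Real.continuous_fourierChar
    (L := innerₗ (EuclideanSpace ℝ (Fin d))) continuous_inner (integrable_ind_unitBall d)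

theorem continuous_kernelHat (d : ℕ) {q : ℝ} (hq : 2 < q) : Continuous (kernelHat d q) :=
  (continuous_fourier_ind d).mul (Complex.continuous_ofReal.comp
    ((continuous_fourier_ind d).norm.rpow_const fun _ => Or.inr (by linarith)))

/-- `(1_𝔹)^ |(1_𝔹)^|^{q-2}` is square integrable. -/
theorem memLp_kernelHat (d : ℕ) {q : ℝ} (hq : 2 < q) : MemLp (kernelHat d q) 2 := by
  have h2 : MemLp (𝓕 (ind (unitBall d))) 2 :=
    (Lp.memLp _).ae_eq (fourier_ae_eq (integrable_ind_unitBall d) (memLp_ind_unitBall d 2))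
  refine h2.of_le_mul (c := (∫ x, ‖ind (unitBall d) x‖) ^ (q - 2))
    (continuous_kernelHat d hq).aestronglyMeasurable (Filter.Eventually.of_forall fun ξ => ?_)
  have hb : ‖𝓕 (ind (unitBall d)) ξ‖ ≤ ∫ x, ‖ind (unitBall d) x‖ :=
    VectorFourier.norm_fourierIntegral_le_integral_norm _ _ _ _ _
  rw [kernelHat, norm_mul, mul_comm, Complex.norm_real,
    Real.norm_of_nonneg (Real.rpow_nonneg (norm_nonneg _) _)]
  gcongr

/-- The element `K_q` of `L²(ℝ^d)` whose Fourier transform is `(1_𝔹)^ |(1_𝔹)^|^{q-2}`. -/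
def kernelLp (d : ℕ) (q : ℝ) (hq : 2 < q) : Lp (α := EuclideanSpace ℝ (Fin d)) ℂ 2 :=
  𝓕⁻ ((memLp_kernelHat d hq).toLp (kernelHat d q))

/-- The kernel `K_q` as a real-valued function (see `kernel_spec`). -/
def kernel (d : ℕ) (q : ℝ) (hq : 2 < q) (x : EuclideanSpace ℝ (Fin d)) : ℝ :=
  ((kernelLp d q hq : EuclideanSpace ℝ (Fin d) → ℂ) x).re

theorem conj_fourier_of_real {d : ℕ} {f : EuclideanSpace ℝ (Fin d) → ℂ}
    (hf : ∀ x, starRingEnd ℂ (f x) = f x) (ξ : EuclideanSpace ℝ (Fin d)) :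
    starRingEnd ℂ (𝓕 f ξ) = 𝓕 f (-ξ) := by
  rw [Real.fourier_eq', Real.fourier_eq', ← integral_conj]
  congr 1 with x
  simp only [smul_eq_mul, map_mul, hf, ← Complex.exp_conj, Complex.conj_ofReal, Complex.conj_I,
    inner_neg_right]
  simp

theorem conj_kernelHat (d : ℕ) (q : ℝ) (ξ : EuclideanSpace ℝ (Fin d)) :
    starRingEnd ℂ (kernelHat d q ξ) = kernelHat d q (-ξ) := by
  have h := conj_fourier_of_real (f := ind (unitBall d))
    (fun x => by by_cases hx : x ∈ unitBall d <;> simp [ind, hx]) ξ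
  rw [kernelHat, kernelHat, ← h, map_mul, Complex.conj_ofReal, RCLike.norm_conj]

/-- `K_q` is real-valued: `kernel` represents `kernelLp` almost everywhere. -/
theorem kernel_ae_eq (d : ℕ) (q : ℝ) (hq : 2 < q) :
    (fun x => ((kernel d q hq x : ℝ) : ℂ)) =ᵐ[volume]
      (kernelLp d q hq : EuclideanSpace ℝ (Fin d) → ℂ) := by
  set K : EuclideanSpace ℝ (Fin d) → ℂ := (kernelLp d q hq : EuclideanSpace ℝ (Fin d) → ℂ)
    with hK
  have hKloc : LocallyIntegrable K := (Lp.memLp _).locallyIntegrable (by norm_num)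
  have him : ∀ᵐ x, (K x).im = 0 := by
    apply ae_eq_zero_of_integral_contDiff_smul_eq_zero
    · intro x
      obtain ⟨s, hs, hi⟩ := hKloc x
      exact ⟨s, hs, hi.im⟩
    intro g hg hgc
    have hg₁ : HasCompactSupport (Complex.ofRealCLM ∘ g) := hgc.comp_left rfl
    have hg₂ : ContDiff ℝ ((⊤ : ℕ∞) : WithTop ℕ∞) (Complex.ofRealCLM ∘ g) := by fun_prop
    set φ : 𝓢(EuclideanSpace ℝ (Fin d), ℂ) := hg₁.toSchwartzMap hg₂ with hφ
    have hφx : ∀ x, φ x = (g x : ℂ) := fun x => rfl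
    have key := congrArg (fun T => T φ) (Lp.fourierInv_toTemperedDistribution_eq
      ((memLp_kernelHat d hq).toLp (kernelHat d q)))
    simp only [TemperedDistribution.fourierInv_apply, Lp.toTemperedDistribution_apply] at key
    have e2 : ∫ x, (𝓕⁻ φ) x • ((memLp_kernelHat d hq).toLp (kernelHat d q) :
        EuclideanSpace ℝ (Fin d) → ℂ) x
        = ∫ x, (𝓕 (φ : EuclideanSpace ℝ (Fin d) → ℂ)) (-x) • kernelHat d q x := by
      apply integral_congr_ae
      filter_upwards [(memLp_kernelHat d hq).coeFn_toLp] with x hx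
      rw [hx, SchwartzMap.fourierInv_coe, Real.fourierInv_eq_fourier_neg]
    rw [e2] at key
    have hreal : starRingEnd ℂ (∫ x, φ x • K x) = ∫ x, φ x • K x := by
      have key' : ∫ x, (𝓕 (φ : EuclideanSpace ℝ (Fin d) → ℂ)) (-x) • kernelHat d q x
        = ∫ x, φ x • K x := key
      rw [← key', ← integral_conj, ← integral_neg_eq_self]
      congr 1 with x
      have := conj_fourier_of_real (f := (φ : EuclideanSpace ℝ (Fin d) → ℂ))
        (fun x => by rw [hφx, Complex.conj_ofReal]) x
      simp only [smul_eq_mul, map_mul, neg_neg, this, conj_kernelHat]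
    have hint : Integrable (fun x => φ x • K x) := by
      have := hKloc.integrable_smul_left_of_hasCompactSupport hg.continuous hgc
      refine this.congr (Filter.Eventually.of_forall fun x => ?_)
      simp [hφx]
    have h0 := Complex.conj_eq_iff_im.1 hreal
    have h1 := integral_im hint
    calc ∫ x, g x • (K x).im = ∫ x, RCLike.im (φ x • K x) := by
          congr 1 with x; simp [hφx]
      _ = 0 := by rw [h1]; exact h0
  filter_upwards [him] with x hx
  apply Complex.ext
  · simp [kernel, hK]
  · simpa using hx.symm

theorem memLp_ofReal_kernel (d : ℕ) (q : ℝ) (hq : 2 < q) :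
    MemLp (fun x => ((kernel d q hq x : ℝ) : ℂ)) 2 :=
  (Lp.memLp (kernelLp d q hq)).ae_eq (kernel_ae_eq d q hq).symm

/-- The defining property: the Fourier transform of the real-valued function `K_q ∈ L²` is
`(1_𝔹)^ |(1_𝔹)^|^{q-2}`. -/
theorem kernel_spec (d : ℕ) (q : ℝ) (hq : 2 < q) :
    ((𝓕 ((memLp_ofReal_kernel d q hq).toLp (fun x => ((kernel d q hq x : ℝ) : ℂ))) : Lp (α := EuclideanSpace ℝ (Fin d)) ℂ 2 volume) :
      EuclideanSpace ℝ (Fin d) → ℂ) =ᵐ[volume] kernelHat d q := by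
  have h : (memLp_ofReal_kernel d q hq).toLp (fun x => ((kernel d q hq x : ℝ) : ℂ)) = kernelLp d q hq :=
    Lp.ext ((memLp_ofReal_kernel d q hq).coeFn_toLp.trans (kernel_ae_eq d q hq))
  rw [h, kernelLp, fourier_fourierInv_eq]
  exact (memLp_kernelHat d hq).coeFn_toLp

end FourierIndicator

end

namespace FourierIndicator

/-!
If `|E| = |𝔹|` and `f = 1_E - 1_𝔹`, convexity of `z ↦ ‖z‖ ^ q` gives the first-order lower bound
`‖(1_E)^‖_q ^ q ≥ ‖(1_𝔹)^‖_q ^ q + q ∫ f K_q`, the linear term being rewritten by Plancherel.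
So if `𝔹` locally maximizes `Φ_q`, then it locally maximizes `∫_E K_q` among sets of its own volume.
A local maximizer `U` of such a linear functional satisfies the bathtub principle: if `K_q > c` on
a non-null set outside `U` and `K_q < c` on a non-null subset of `U`, exchanging small pieces of
equal volume of these two sets would increase the integral.
-/

open Set Filter
open scoped Topology RealInnerProductSpace

theorem add_le_of_convexOn_of_hasFDerivAt {E : Type*} [NormedAddCommGroup E] [NormedSpace ℝ E]
    {f : E → ℝ} {f' : E →L[ℝ] ℝ} {x : E} (hf : ConvexOn ℝ univ f) (hf' : HasFDerivAt f f' x)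
    (v : E) : f x + f' v ≤ f (x + v) := by
  have hconv : ConvexOn ℝ univ (f ∘ AffineMap.lineMap x (x + v)) := hf.comp_affineMap _
  have hderiv : HasDerivAt (f ∘ AffineMap.lineMap (k := ℝ) x (x + v)) (f' v) 0 := by
    refine HasFDerivAt.comp_hasDerivAt (0 : ℝ) (by simpa using hf') ?_
    simpa using AffineMap.hasDerivAt_lineMap (a := x) (b := x + v) (x := (0 : ℝ))
  have h := hconv.le_slope_of_hasDerivAt (mem_univ 0) (mem_univ 1) one_pos hderiv
  simp only [slope_def_field, Function.comp_apply, AffineMap.lineMap_apply_one,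
    AffineMap.lineMap_apply_zero, sub_zero, div_one] at h
  linarith

theorem convexOn_norm_rpow {E : Type*} [SeminormedAddCommGroup E] [NormedSpace ℝ E] {p : ℝ}
    (hp : 1 ≤ p) : ConvexOn ℝ univ fun x : E => ‖x‖ ^ p := by
  refine ⟨convex_univ, fun x _ y _ a b ha hb hab => ?_⟩
  calc ‖a • x + b • y‖ ^ p ≤ (a • ‖x‖ + b • ‖y‖) ^ p := by
        gcongr
        exact convexOn_univ_norm.2 (mem_univ x) (mem_univ y) ha hb hab
    _ ≤ a • ‖x‖ ^ p + b • ‖y‖ ^ p :=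
        (convexOn_rpow hp).2 (norm_nonneg x) (norm_nonneg y) ha hb hab

section LpVariation

variable {α E : Type*} {m : MeasurableSpace α} {μ : Measure α} [NormedAddCommGroup E]
  {p : ℝ} {u v : α → E}

theorem integrable_norm_rpow_of_memLp_ofReal (hp : 0 < p) (hu : MemLp u (.ofReal p) μ) :
    Integrable (fun x => ‖u x‖ ^ p) μ := by
  simpa only [ENNReal.toReal_ofReal hp.le] using
    hu.integrable_norm_rpow (ENNReal.ofReal_pos.2 hp).ne' ENNReal.ofReal_ne_top

theorem eLpNorm_ofReal_le_eLpNorm_ofReal_iff (hp : 0 < p) (hu : MemLp u (.ofReal p) μ)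
    (hv : MemLp v (.ofReal p) μ) :
    eLpNorm u (.ofReal p) μ ≤ eLpNorm v (.ofReal p) μ ↔
      ∫ x, ‖u x‖ ^ p ∂μ ≤ ∫ x, ‖v x‖ ^ p ∂μ := by
  have hp' : ENNReal.ofReal p ≠ 0 := (ENNReal.ofReal_pos.2 hp).ne'
  rw [hu.eLpNorm_eq_integral_rpow_norm hp' ENNReal.ofReal_ne_top,
    hv.eLpNorm_eq_integral_rpow_norm hp' ENNReal.ofReal_ne_top,
    ENNReal.toReal_ofReal hp.le, ENNReal.ofReal_le_ofReal_iff (by positivity),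
    Real.rpow_le_rpow_iff (by positivity) (by positivity) (by positivity)]

variable [InnerProductSpace ℝ E]

theorem norm_rpow_add_le_norm_add_rpow (hp : 1 < p) (a b : E) :
    ‖a‖ ^ p + p * (‖a‖ ^ (p - 2) * ⟪a, b⟫) ≤ ‖a + b‖ ^ p := by
  simpa [mul_assoc] using
    add_le_of_convexOn_of_hasFDerivAt (convexOn_norm_rpow hp.le) (hasFDerivAt_norm_rpow a hp) b

theorem integrable_norm_rpow_mul_inner (hp : 1 < p) (hu : MemLp u (.ofReal p) μ)
    (hv : MemLp v (.ofReal p) μ) : Integrable (fun x => ‖u x‖ ^ (p - 2) * ⟪u x, v x⟫) μ := by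
  have hp0 : 0 < p := by linarith
  have hbound := ((integrable_norm_rpow_of_memLp_ofReal hp0 (hu.add hv)).add
    (integrable_norm_rpow_of_memLp_ofReal hp0 (hu.sub hv))).const_mul p⁻¹
  refine hbound.mono' ((hu.1.norm.aemeasurable.pow_const _).aestronglyMeasurable.mul
    (hu.1.inner hv.1)) (.of_forall fun x => ?_)
  have hadd := norm_rpow_add_le_norm_add_rpow hp (u x) (v x)
  have hsub := norm_rpow_add_le_norm_add_rpow hp (u x) (-v x)
  rw [inner_neg_right, ← sub_eq_add_neg] at hsub
  have hnorm : 0 ≤ ‖u x‖ ^ p := by positivity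
  have hadd' : 0 ≤ ‖u x + v x‖ ^ p := by positivity
  have hsub' : 0 ≤ ‖u x - v x‖ ^ p := by positivity
  simp only [Pi.add_apply, Pi.sub_apply]
  rw [Real.norm_eq_abs, le_inv_mul_iff₀ hp0, ← abs_of_pos hp0, ← abs_mul, abs_of_pos hp0, abs_le]
  constructor <;> linarith

theorem integral_norm_rpow_mul_inner_nonpos (hp : 1 < p) (hu : MemLp u (.ofReal p) μ)
    (hv : MemLp v (.ofReal p) μ)
    (h : eLpNorm (u + v) (.ofReal p) μ ≤ eLpNorm u (.ofReal p) μ) :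
    ∫ x, ‖u x‖ ^ (p - 2) * ⟪u x, v x⟫ ∂μ ≤ 0 := by
  have hp0 : 0 < p := by linarith
  have hle := (eLpNorm_ofReal_le_eLpNorm_ofReal_iff hp0 (hu.add hv) hu).1 h
  have hiu := integrable_norm_rpow_of_memLp_ofReal hp0 hu
  have hiuv := integrable_norm_rpow_of_memLp_ofReal hp0 (hu.add hv)
  have hiinner := (integrable_norm_rpow_mul_inner hp hu hv).const_mul p
  have htangent : ∫ x, ‖u x‖ ^ p ∂μ + p * ∫ x, ‖u x‖ ^ (p - 2) * ⟪u x, v x⟫ ∂μ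
      ≤ ∫ x, ‖(u + v) x‖ ^ p ∂μ := by
    rw [← integral_const_mul, ← integral_add hiu hiinner]
    exact integral_mono (hiu.add hiinner) hiuv fun x =>
      norm_rpow_add_le_norm_add_rpow hp (u x) (v x)
  exact nonpos_of_mul_nonpos_right (by linarith) hp0

end LpVariation

theorem memLp_of_memLp_of_bound {α E : Type*} {m : MeasurableSpace α} {μ : Measure α}
    [NormedAddCommGroup E] {f : α → E} {p q : ℝ≥0∞} (hf : MemLp f p μ) (hp : p ≠ 0) (hpq : p ≤ q)
    {C : ℝ} (hC : ∀ᵐ x ∂μ, ‖f x‖ ≤ C) : MemLp f q μ := by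
  obtain rfl | hq := eq_or_ne q ∞
  · exact memLp_top_of_bound hf.1 C hC
  have hp' : p ≠ ∞ := ne_top_of_le_ne_top hq hpq
  have hq' : q ≠ 0 := (hp.bot_lt.trans_le hpq).ne'
  have hr : 1 ≤ (q / p).toReal := by
    rw [ENNReal.toReal_div, one_le_div (ENNReal.toReal_pos hp hp')]
    exact ENNReal.toReal_mono hq hpq
  rw [← memLp_norm_rpow_iff hf.1 (ENNReal.div_ne_zero.2 ⟨hq', hp'⟩) (ENNReal.div_ne_top hq hp),
    ENNReal.div_div_cancel hq' hq]
  refine hf.of_le_mul (c := C ^ ((q / p).toReal - 1))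
    (hf.1.norm.aemeasurable.pow_const _).aestronglyMeasurable ?_
  filter_upwards [hC] with x hx
  calc ‖‖f x‖ ^ (q / p).toReal‖ = ‖f x‖ ^ ((q / p).toReal - 1) * ‖f x‖ := by
        rw [Real.norm_of_nonneg (by positivity),
          ← Real.rpow_add_one' (norm_nonneg _) (by linarith), sub_add_cancel]
    _ ≤ C ^ ((q / p).toReal - 1) * ‖f x‖ := by gcongr

theorem continuous_measure_Iic {X : Type*} [TopologicalSpace X] [FirstCountableTopology X]
    [LinearOrder X] [OrderTopology X] [MeasurableSpace X] [OpensMeasurableSpace X]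
    (ν : Measure X) [IsFiniteMeasure ν] [NullSingletonClass ν] :
    Continuous fun r => ν (Iic r) := by
  refine continuous_iff_continuousAt.2 fun r =>
    tendsto_measure_of_ae_tendsto_indicator_of_isFiniteMeasure (𝓝 r) measurableSet_Iic
      (fun _ => measurableSet_Iic) ?_
  filter_upwards [measure_eq_zero_iff_ae_notMem.1 (measure_singleton (μ := ν) r)] with x hx
  obtain hlt | hgt := lt_or_gt_of_ne (show x ≠ r from hx)
  · filter_upwards [lt_mem_nhds hlt] with s hs using by simp [hs.le, hlt.le]
  · filter_upwards [gt_mem_nhds hgt] with s hs using by simp [hs.not_ge, hgt.not_ge]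

theorem tendsto_measure_Iic_atBot {X : Type*} [TopologicalSpace X] [Preorder X]
    [ClosedIicTopology X] [NoBotOrder X] [(atBot : Filter X).IsCountablyGenerated]
    [MeasurableSpace X] [OpensMeasurableSpace X] (ν : Measure X) [IsFiniteMeasure ν] :
    Tendsto (fun r => ν (Iic r)) atBot (𝓝 0) := by
  rw [← measure_empty (μ := ν)]
  refine tendsto_measure_of_ae_tendsto_indicator_of_isFiniteMeasure atBot .empty
    (fun _ => measurableSet_Iic) (.of_forall fun x => ?_)
  filter_upwards [eventually_lt_atBot x] with r hr using by simp [hr.not_ge]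

theorem exists_measure_Iic_eq (ν : Measure ℝ) [IsFiniteMeasure ν] [NullSingletonClass ν]
    {c : ℝ≥0∞} (hc : c ≠ 0) (hcν : c < ν univ) : ∃ r, ν (Iic r) = c := by
  obtain ⟨r, -, hr⟩ := isPreconnected_univ.intermediate_value_Ioo (l₁ := atBot) (l₂ := atTop)
    (by simp) (by simp) (continuous_measure_Iic ν).continuousOn (tendsto_measure_Iic_atBot ν)
    (tendsto_measure_Iic_atTop ν) ⟨hc.bot_lt, hcν⟩
  exact ⟨r, hr⟩

theorem exists_subset_measure_eq {α : Type*} [MeasurableSpace α] [StandardBorelSpace α]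
    {μ : Measure α} [SigmaFinite μ] [NullSingletonClass μ] {s : Set α} (hs : MeasurableSet s)
    {c : ℝ≥0∞} (hc : c ≤ μ s) : ∃ t ⊆ s, MeasurableSet t ∧ μ t = c := by
  obtain rfl | hlt := hc.eq_or_lt
  · exact ⟨s, subset_rfl, hs, rfl⟩
  obtain rfl | hc0 := eq_or_ne c 0
  · exact ⟨∅, empty_subset s, .empty, measure_empty⟩
  obtain ⟨t, ht, hts, hct, htfin⟩ := Measure.exists_subset_measure_lt_top hs hlt
  have : Fact (μ t < ∞) := ⟨htfin⟩
  have hι := measurableEmbedding_embeddingReal α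
  have : NullSingletonClass ((μ.restrict t).map (embeddingReal α)) := ⟨fun r => by
    rw [hι.map_apply]
    exact (subsingleton_singleton.preimage hι.injective).measure_zero _⟩
  obtain ⟨r, hr⟩ := exists_measure_Iic_eq ((μ.restrict t).map (embeddingReal α)) hc0
    (by simpa [hι.map_apply] using hct)
  refine ⟨embeddingReal α ⁻¹' Iic r ∩ t, inter_subset_right.trans hts,
    (hι.measurable measurableSet_Iic).inter ht, ?_⟩
  rw [← hr, hι.map_apply, Measure.restrict_apply (hι.measurable measurableSet_Iic)]

section Bathtub

variable {α : Type*} [MeasurableSpace α] {μ : Measure α} {k : α → ℝ} {U A B : Set α}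

/-- `U` is a local maximizer, among measurable sets of the same measure and with respect to the
measure of the symmetric difference, of the linear functional `E ↦ ∫ x in E, k x ∂μ`. -/
def IsLocalMaxSetIntegral (k : α → ℝ) (U : Set α) (μ : Measure α) : Prop :=
  ∃ ε > 0, ∀ E, MeasurableSet E → μ E = μ U → μ (U ∆ E) < ε → ∫ x in E, k x ∂μ ≤ ∫ x in U, k x ∂μ

theorem measure_sdiff_union_eq (hA : MeasurableSet A) (hB : MeasurableSet B) (hAU : Disjoint U A)
    (hBU : B ⊆ U) (hAB : μ A = μ B) : μ (U \ B ∪ A) = μ U := by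
  rw [measure_union (hAU.mono_left sdiff_subset) hA, hAB, add_comm,
    measure_add_sdiff hB.nullMeasurableSet, union_eq_right.2 hBU]

theorem measure_symmDiff_sdiff_union_le : μ (U ∆ (U \ B ∪ A)) ≤ μ A + μ B := by
  refine (measure_mono fun x hx => ?_).trans (measure_union_le A B)
  simp only [mem_symmDiff, mem_union, Set.mem_sdiff] at hx ⊢
  tauto

theorem setIntegral_sdiff_union (hA : MeasurableSet A) (hB : MeasurableSet B) (hAU : Disjoint U A)
    (hBU : B ⊆ U) (hkU : IntegrableOn k U μ) (hkA : IntegrableOn k A μ) :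
    ∫ x in U \ B ∪ A, k x ∂μ = ∫ x in U, k x ∂μ - ∫ x in B, k x ∂μ + ∫ x in A, k x ∂μ := by
  rw [setIntegral_union (hAU.mono_left sdiff_subset) hA (hkU.mono_set sdiff_subset) hkA,
    setIntegral_sdiff hB hkU hBU]

theorem setIntegral_lt_setIntegral_of_forall_lt {c : ℝ} (hAB : μ A = μ B) (hA0 : μ A ≠ 0)
    (hAfin : μ A ≠ ∞) (hkA : IntegrableOn k A μ) (hkB : IntegrableOn k B μ)
    (hcA : ∀ x ∈ A, c < k x) (hcB : ∀ x ∈ B, k x < c) :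
    ∫ x in B, k x ∂μ < ∫ x in A, k x ∂μ := by
  obtain ⟨a, ha, hka⟩ := exists_le_setAverage hA0 hAfin hkA
  obtain ⟨b, hb, hkb⟩ := exists_setAverage_le (hAB ▸ hA0) (hAB ▸ hAfin) hkB
  have havg : ⨍ x in B, k x ∂μ < ⨍ x in A, k x ∂μ :=
    hkb.trans_lt ((hcB b hb).trans ((hcA a ha).trans_le hka))
  rw [setAverage_eq, setAverage_eq, measureReal_def, measureReal_def, ← hAB] at havg
  exact lt_of_smul_lt_smul_of_nonneg_left havg (by positivity)

theorem IsLocalMaxSetIntegral.exists_forall_setIntegral_le (hmax : IsLocalMaxSetIntegral k U μ)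
    (hU : MeasurableSet U) (hUfin : μ U < ∞)
    (hk : ∀ s, MeasurableSet s → μ s < ∞ → IntegrableOn k s μ) :
    ∃ δ > 0, ∀ A B, MeasurableSet A → MeasurableSet B → Disjoint U A → B ⊆ U → μ A = μ B →
      μ A < δ → ∫ x in A, k x ∂μ ≤ ∫ x in B, k x ∂μ := by
  obtain ⟨ε, hε, hmax⟩ := hmax
  refine ⟨ε / 2, ENNReal.half_pos hε.ne', fun A B hA hB hAU hBU hAB hAε => ?_⟩
  have hclose : μ (U ∆ (U \ B ∪ A)) < ε :=
    calc μ (U ∆ (U \ B ∪ A)) ≤ μ A + μ B := measure_symmDiff_sdiff_union_le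
      _ < ε / 2 + ε / 2 := ENNReal.add_lt_add hAε (hAB ▸ hAε)
      _ = ε := ENNReal.add_halves ε
  have hle := hmax _ ((hU.diff hB).union hA) (measure_sdiff_union_eq hA hB hAU hBU hAB) hclose
  rw [setIntegral_sdiff_union hA hB hAU hBU (hk U hU hUfin) (hk A hA (hAε.trans_le le_top))] at hle
  linarith

theorem IsLocalMaxSetIntegral.measure_eq_zero_or [StandardBorelSpace α] [SigmaFinite μ]
    [NullSingletonClass μ] {c : ℝ} (hmax : IsLocalMaxSetIntegral k U μ) (hU : MeasurableSet U)
    (hUfin : μ U < ∞) (hk : ∀ s, MeasurableSet s → μ s < ∞ → IntegrableOn k s μ)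
    (hA : MeasurableSet A) (hB : MeasurableSet B) (hAU : Disjoint U A) (hBU : B ⊆ U)
    (hcA : ∀ x ∈ A, c < k x) (hcB : ∀ x ∈ B, k x < c) : μ A = 0 ∨ μ B = 0 := by
  by_contra! h
  obtain ⟨δ, hδ, hle⟩ := hmax.exists_forall_setIntegral_le hU hUfin hk
  obtain ⟨r, hr, hrlt⟩ := exists_between (lt_min hδ (lt_min h.1.bot_lt h.2.bot_lt))
  obtain ⟨hrδ, hrA, hrB⟩ : r < δ ∧ r < μ A ∧ r < μ B := by simpa only [lt_min_iff] using hrlt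
  obtain ⟨A', hA'A, hA', rfl⟩ := exists_subset_measure_eq hA hrA.le
  obtain ⟨B', hB'B, hB', hA'B'⟩ := exists_subset_measure_eq hB hrB.le
  have hfin : μ A' < ∞ := hrδ.trans_le le_top
  have hgain : ∫ x in B', k x ∂μ < ∫ x in A', k x ∂μ :=
    setIntegral_lt_setIntegral_of_forall_lt hA'B'.symm hr.ne' hfin.ne (hk A' hA' hfin)
      (hk B' hB' (hA'B' ▸ hfin)) (fun x hx => hcA x (hA'A hx)) fun x hx => hcB x (hB'B hx)
  exact hgain.not_ge
    (hle A' B' hA' hB' (hAU.mono_right hA'A) (hB'B.trans hBU) hA'B'.symm hrδ)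

theorem essSup_le_essInf_of_forall_or {β : Type*} [MeasurableSpace β] {ν : Measure β} {l : β → ℝ}
    (h : ∀ c : ℝ, (∀ᵐ x ∂μ, k x ≤ c) ∨ ∀ᵐ y ∂ν, c ≤ l y) :
    essSup (fun x => (k x : EReal)) μ ≤ essInf (fun y => (l y : EReal)) ν := by
  by_contra! hlt
  obtain ⟨c, hinf, hsup⟩ := EReal.lt_iff_exists_real_btwn.1 hlt
  obtain hle | hge := h c
  · exact hsup.not_ge (essSup_le_of_ae_le _ (by simpa [EventuallyLE] using hle))
  · exact hinf.not_ge (le_essInf_of_ae_le _ (by simpa [EventuallyLE] using hge))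

theorem IsLocalMaxSetIntegral.essSup_le_essInf [StandardBorelSpace α] [SigmaFinite μ]
    [NullSingletonClass μ] (hmax : IsLocalMaxSetIntegral k U μ) (hU : MeasurableSet U)
    (hUfin : μ U < ∞) (hkm : Measurable k)
    (hk : ∀ s, MeasurableSet s → μ s < ∞ → IntegrableOn k s μ) :
    essSup (fun x => (k x : EReal)) (μ.restrict Uᶜ) ≤
      essInf (fun x => (k x : EReal)) (μ.restrict U) := by
  refine essSup_le_essInf_of_forall_or fun c => ?_
  have hgt : MeasurableSet {x | c < k x} := measurableSet_lt measurable_const hkm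
  have hlt : MeasurableSet {x | k x < c} := measurableSet_lt hkm measurable_const
  simp only [ae_iff, not_le]
  rw [Measure.restrict_apply hgt, Measure.restrict_apply hlt]
  exact hmax.measure_eq_zero_or hU hUfin hk (hgt.inter hU.compl) (hlt.inter hU)
    (disjoint_compl_right.mono_right inter_subset_right) inter_subset_right
    (fun x hx => hx.1) fun x hx => hx.1

end Bathtub

section Kernel

variable {d : ℕ} {q : ℝ} {E F : Set (EuclideanSpace ℝ (Fin d))}
  {f : EuclideanSpace ℝ (Fin d) → ℂ}

theorem memLp_fourier (hf1 : Integrable f) (hf2 : MemLp f 2) {p : ℝ≥0∞} (hp : 2 ≤ p) :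
    MemLp (𝓕 f) p :=
  memLp_of_memLp_of_bound ((Lp.memLp _).ae_eq (fourier_ae_eq hf1 hf2)) two_ne_zero hp
    (.of_forall fun _ => VectorFourier.norm_fourierIntegral_le_integral_norm _ _ _ _ _)

theorem fourier_add_of_integrable {V W : Type*} [NormedAddCommGroup V] [InnerProductSpace ℝ V]
    [FiniteDimensional ℝ V] [MeasurableSpace V] [BorelSpace V] [NormedAddCommGroup W]
    [NormedSpace ℂ W] {f g : V → W} (hf : Integrable f) (hg : Integrable g) :
    𝓕 (f + g) = 𝓕 f + 𝓕 g :=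
  VectorFourier.fourierIntegral_add Real.continuous_fourierChar (L := innerₗ V) continuous_inner
    hf hg

theorem memLp_ind (hE : MeasurableSet E) (hfin : volume E ≠ ∞) (p : ℝ≥0∞) : MemLp (ind E) p :=
  memLp_indicator_const p hE 1 (.inr hfin)

theorem integrable_ind (hE : MeasurableSet E) (hfin : volume E ≠ ∞) : Integrable (ind E) :=
  memLp_one_iff_integrable.1 (memLp_ind hE hfin 1)

theorem volume_unitBall_pos (d : ℕ) : 0 < volume (unitBall d) := by
  have hball : unitBall d = Metric.closedBall 0 1 := by ext x; simp [unitBall]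
  exact hball ▸ Metric.measure_closedBall_pos volume _ one_pos

theorem isEllipsoid_unitBall (d : ℕ) : IsEllipsoid (unitBall d) :=
  ⟨AffineEquiv.refl ℝ _, by simp⟩

theorem distEllipsoids_le_of_volume_eq (hE : IsEllipsoid E) (h : volume E = volume F) :
    distEllipsoids F ≤ volume (E ∆ F) / volume F :=
  iInf₂_le_of_le E hE (iInf_le _ h)

theorem Phi_le_Phi_iff_of_volume_eq (h : volume E = volume F) (hpos : volume F ≠ 0)
    (hfin : volume F ≠ ∞) :
    Phi q E ≤ Phi q F ↔
      eLpNorm (𝓕 (ind E)) (.ofReal q) volume ≤ eLpNorm (𝓕 (ind F)) (.ofReal q) volume := by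
  rw [Phi, Phi, h, ENNReal.mul_le_mul_iff_right (ENNReal.rpow_pos hpos.bot_lt hfin).ne'
    (ENNReal.rpow_ne_top_of_ne_zero hpos hfin)]

theorem measurable_kernel (hq : 2 < q) : Measurable (kernel d q hq) :=
  Complex.measurable_re.comp (Lp.stronglyMeasurable _).measurable

theorem integrableOn_kernel (hq : 2 < q) (hE : volume E < ∞) : IntegrableOn (kernel d q hq) E := by
  have : Fact (volume E < ∞) := ⟨hE⟩
  exact (((memLp_ofReal_kernel d q hq).restrict E).integrable (by norm_num)).re

theorem re_inner_kernelHat (ξ : EuclideanSpace ℝ (Fin d)) (z : ℂ) :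
    (inner ℂ (kernelHat d q ξ) z).re =
      ‖𝓕 (ind (unitBall d)) ξ‖ ^ (q - 2) * ⟪𝓕 (ind (unitBall d)) ξ, z⟫ := by
  rw [kernelHat, mul_comm, ← Complex.real_smul, real_inner_eq_re_inner ℂ,
    ← Complex.coe_smul, inner_smul_left]
  simp

theorem integral_inner_kernelHat_fourier (hq : 2 < q) (hf1 : Integrable f) (hf2 : MemLp f 2) :
    ∫ ξ, (inner ℂ (kernelHat d q ξ) (𝓕 f ξ) : ℂ) = ∫ x, f x * (kernel d q hq x : ℂ) := by
  have hplancherel := Lp.inner_fourier_eq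
    ((memLp_ofReal_kernel d q hq).toLp fun x => (kernel d q hq x : ℂ)) (hf2.toLp f)
  rw [L2.inner_def, L2.inner_def] at hplancherel
  refine .trans (integral_congr_ae ?_) (hplancherel.trans (integral_congr_ae ?_))
  · filter_upwards [kernel_spec d q hq, fourier_ae_eq hf1 hf2] with ξ hK hf
    rw [hK, hf]
  · filter_upwards [(memLp_ofReal_kernel d q hq).coeFn_toLp, hf2.coeFn_toLp] with x hK hf
    rw [hK, hf, RCLike.inner_apply, Complex.conj_ofReal]

theorem integral_norm_rpow_mul_inner_fourier (hq : 2 < q) (hf1 : Integrable f)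
    (hf2 : MemLp f 2) :
    ∫ ξ, ‖𝓕 (ind (unitBall d)) ξ‖ ^ (q - 2) * ⟪𝓕 (ind (unitBall d)) ξ, 𝓕 f ξ⟫ =
      ∫ x, (f x).re * kernel d q hq x := by
  have hint : Integrable fun ξ => (inner ℂ (kernelHat d q ξ) (𝓕 f ξ) : ℂ) :=
    (memLp_fourier hf1 hf2 le_rfl).integrable_mul (memLp_kernelHat d hq).star
  have hint' : Integrable fun x => f x * (kernel d q hq x : ℂ) :=
    hf2.integrable_mul (memLp_ofReal_kernel d q hq)
  calc ∫ ξ, ‖𝓕 (ind (unitBall d)) ξ‖ ^ (q - 2) * ⟪𝓕 (ind (unitBall d)) ξ, 𝓕 f ξ⟫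
      = (∫ ξ, (inner ℂ (kernelHat d q ξ) (𝓕 f ξ) : ℂ)).re := by
        simp only [← re_inner_kernelHat]; exact integral_re hint
    _ = (∫ x, f x * (kernel d q hq x : ℂ)).re := by rw [integral_inner_kernelHat_fourier hq hf1 hf2]
    _ = ∫ x, (f x).re * kernel d q hq x := by
        rw [← RCLike.re_eq_complex_re, ← integral_re hint']
        simp

theorem integral_re_mul_kernel_nonpos (hq : 2 < q) (hf1 : Integrable f) (hf2 : MemLp f 2)
    (h : eLpNorm (𝓕 (ind (unitBall d) + f)) (.ofReal q) volume ≤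
      eLpNorm (𝓕 (ind (unitBall d))) (.ofReal q) volume) :
    ∫ x, (f x).re * kernel d q hq x ≤ 0 := by
  have hq' : 2 ≤ ENNReal.ofReal q := by simpa using ENNReal.ofReal_le_ofReal hq.le
  rw [fourier_add_of_integrable (integrable_ind_unitBall d) hf1] at h
  rw [← integral_norm_rpow_mul_inner_fourier hq hf1 hf2]
  exact integral_norm_rpow_mul_inner_nonpos (by linarith)
    (memLp_fourier (integrable_ind_unitBall d) (memLp_ind_unitBall d 2) hq')
    (memLp_fourier hf1 hf2 hq') h

theorem integral_ind_sub_ind_mul_kernel (hq : 2 < q) (hE : MeasurableSet E) (hEfin : volume E < ∞)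
    (hF : MeasurableSet F) (hFfin : volume F < ∞) :
    ∫ x, ((ind E - ind F) x).re * kernel d q hq x =
      (∫ x in E, kernel d q hq x) - ∫ x in F, kernel d q hq x := by
  have hind (S : Set (EuclideanSpace ℝ (Fin d))) (x : EuclideanSpace ℝ (Fin d)) :
      (ind S x).re * kernel d q hq x = S.indicator (kernel d q hq) x := by
    by_cases hx : x ∈ S <;> simp [ind, hx]
  simp only [Pi.sub_apply, Complex.sub_re, sub_mul, hind]
  rw [integral_sub ((integrableOn_kernel hq hEfin).integrable_indicator hE)
    ((integrableOn_kernel hq hFfin).integrable_indicator hF), integral_indicator hE,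
    integral_indicator hF]

theorem EllipsoidsLocalMax.isLocalMaxSetIntegral_kernel (h : EllipsoidsLocalMax d q)
    (hq : 2 < q) : IsLocalMaxSetIntegral (kernel d q hq) (unitBall d) volume := by
  obtain ⟨η, hη, hmax⟩ := h
  have hpos := volume_unitBall_pos d
  have hfin := volume_unitBall_lt_top d
  refine ⟨.ofReal η * volume (unitBall d),
    ENNReal.mul_pos (ENNReal.ofReal_pos.2 hη).ne' hpos.ne', fun E hE hvol hclose => ?_⟩
  have hEfin : volume E < ∞ := hvol ▸ hfin
  have hdist : distEllipsoids E < .ofReal η := by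
    refine (distEllipsoids_le_of_volume_eq (isEllipsoid_unitBall d) hvol.symm).trans_lt ?_
    rwa [hvol, ENNReal.div_lt_iff (.inl hpos.ne') (.inl hfin.ne)]
  have hnorm := (Phi_le_Phi_iff_of_volume_eq hvol hpos.ne' hfin.ne).1
    (hmax E hE.nullMeasurableSet (hvol ▸ hpos) hEfin hdist)
  rw [← add_sub_cancel (ind (unitBall d)) (ind E)] at hnorm
  rw [← sub_nonpos, ← integral_ind_sub_ind_mul_kernel hq hE hEfin (measurableSet_unitBall d) hfin]
  exact integral_re_mul_kernel_nonpos hq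
    ((integrable_ind hE hEfin.ne).sub (integrable_ind_unitBall d))
    ((memLp_ind hE hEfin.ne 2).sub (memLp_ind_unitBall d 2)) hnorm

theorem ae_eq_compl_unitBall [Nonempty (Fin d)] :
    {x : EuclideanSpace ℝ (Fin d) | 1 ≤ ‖x‖} =ᵐ[volume] (unitBall d)ᶜ := by
  have hsphere : ∀ᵐ x : EuclideanSpace ℝ (Fin d), x ∉ Metric.sphere 0 1 :=
    measure_eq_zero_iff_ae_notMem.1 (Measure.addHaar_sphere volume 0 1)
  filter_upwards [hsphere] with x hx
  have hne : 1 ≠ ‖x‖ := fun h => hx (mem_sphere_zero_iff_norm.2 h.symm)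
  exact propext ((le_iff_lt_or_eq.trans (or_iff_left hne)).trans not_le.symm)

end Kernel

end FourierIndicator

theorem proposition2p4 (d : ℕ) (hd : 1 ≤ d) (q : ℝ) (hq : 2 < q)
    (hmax : FourierIndicator.EllipsoidsLocalMax d q) :
    essSup (fun x => ((FourierIndicator.kernel d q hq x : ℝ) : EReal))
        (volume.restrict {x : EuclideanSpace ℝ (Fin d) | 1 ≤ ‖x‖}) ≤
      essInf (fun x => ((FourierIndicator.kernel d q hq x : ℝ) : EReal))
        (volume.restrict {x : EuclideanSpace ℝ (Fin d) | ‖x‖ ≤ 1}) := by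
  have : Nonempty (Fin d) := ⟨⟨0, hd⟩⟩
  rw [Measure.restrict_congr_set FourierIndicator.ae_eq_compl_unitBall]
  exact (hmax.isLocalMaxSetIntegral_kernel hq).essSup_le_essInf
    (FourierIndicator.measurableSet_unitBall d) (FourierIndicator.volume_unitBall_lt_top d)
    (FourierIndicator.measurable_kernel hq)
    fun _ _ hfin => FourierIndicator.integrableOn_kernel hq hfin
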